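/- Let $(A,\mathfrak m)$ be a reduced Noetherian local ring, $I$ an ideal of $A$, and $a\in A$. Let $R=A[It]=\bigoplus_{d\ge 0}I^dt^d\subseteq A[t]$ be the Rees algebra of $I$, and let $S=\overline R$ be its normalization, i.e. the integral closure of $R$ in its total ring of fractions, with the $\mathbb N$-grading that extends the grading of $R$: a homogeneous element of $S$ of degree $d$ is one that some nonzerodivisor of $A$ multiplies into $I^dt^d$. Let $\overline I$ be the integral closure of $I$, i.e. the set of all $a\in A$ satisfying $a^n+c_1a^{n-1}+\cdots+c_n=0$ for some $n\ge 1$ and $c_i\in I^i$. Let $\mathrm{Proj}(S)$ be the set of homogeneous prime ideals $\mathfrak q$ of $S$ not containing $S_+=\bigoplus_{d>0}S_d$, and for such $\mathfrak q$ let $S_{(\mathfrak q)}$ be the degree $0$ part of the localization of $S$ at the homogeneous elements outside $\mathfrak q$. Consider the condition $$(*)\qquad a\in IS_{(\mathfrak q)}\ \text{ for every } \mathfrak q\in\mathrm{Proj}(S) \text{ such that } \mathfrak q\cap A=\mathfrak m .$$ 1. If $a\in\overline I$, then $(*)$ holds. 2. Conversely, suppose that $a$ lies in every minimal prime of $A$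 that contains $I$ (this is automatic if $I$ contains a nonzerodivisor). If $(*)$ holds, then $a\in\overline I$. In particular, if $I$ contains a nonzerodivisor of $A$, then $a\in\overline I\iff(*)$. -/

import Mathlib

open Polynomial nonZeroDivisors

noncomputable section

namespace ReesNormalization

variable {A : Type*} [CommRing A]

/-- The homogeneous element `r t ^ d` of the Rees algebra `A[It]`, for `r ∈ I ^ d`. -/
def reesMonomial (I : Ideal A) (d : ℕ) : ↥(I ^ d) →ₗ[A] reesAlgebra I where
  toFun r := ⟨monomial d (r : A), reesAlgebra.monomial_mem.2 r.2⟩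
  map_add' r r' := Subtype.ext (by simp)
  map_smul' c r := Subtype.ext (by simp [smul_monomial])

/-- The normalization of the Rees algebra `A[It]`: its integral closure in its total ring of
fractions. -/
abbrev NormalizedRees (I : Ideal A) :
    Subalgebra (reesAlgebra I) (FractionRing (reesAlgebra I)) :=
  integralClosure (reesAlgebra I) (FractionRing (reesAlgebra I))

instance (I : Ideal A) : CommRing (NormalizedRees I) := inferInstance
instance (I : Ideal A) : Ring (NormalizedRees I) := inferInstance
instance (I : Ideal A) : AddCommGroup (NormalizedRees I) := inferInstance
instance (I : Ideal A) : AddCommMonoid (NormalizedRees I) := inferInstance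
instance (I : Ideal A) : Algebra A (NormalizedRees I) := inferInstance
instance (I : Ideal A) : Module A (NormalizedRees I) := inferInstance

theorem reesAlgebra_nonZeroDivisors {I : Ideal A} {g : reesAlgebra I}
    (hg : g ∈ (reesAlgebra I)⁰) : (g : A[X]) ∈ A[X]⁰ := by
  by_contra h
  obtain ⟨a, ha, h⟩ := Polynomial.notMem_nonZeroDivisors_iff.1 h
  apply ha
  have : a • g = 0 := Subtype.ext h
  rw [Algebra.smul_def] at this
  have h2 := (mem_nonZeroDivisors_iff_right.1 hg) _ this
  have h3 : (C a : A[X]) = 0 := congrArg Subtype.val h2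
  exact C_eq_zero.1 h3

theorem algebraMap_nonZeroDivisors (I : Ideal A) {s : A} (hs : s ∈ A⁰) :
    algebraMap A (reesAlgebra I) s ∈ (reesAlgebra I)⁰ := by
  rw [mem_nonZeroDivisors_iff_right]
  intro z hz
  have hz' : (z : A[X]) * C s = 0 := congrArg Subtype.val hz
  apply Subtype.ext
  ext n
  have := congrArg (fun p => coeff p n) hz'
  simp only [coeff_mul_C, coeff_zero] at this
  simpa using (mem_nonZeroDivisors_iff_right.1 hs) _ this

theorem isUnit_algebraMap (I : Ideal A) {s : A} (hs : s ∈ A⁰) :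
    IsUnit (algebraMap A (FractionRing (reesAlgebra I)) s) := by
  rw [IsScalarTower.algebraMap_apply A (reesAlgebra I)]
  exact IsLocalization.map_units (M := (reesAlgebra I)⁰) _ ⟨_, algebraMap_nonZeroDivisors I hs⟩

theorem algebraMap_smul_eq (I : Ideal A) (c : A) (f : reesAlgebra I) :
    algebraMap (reesAlgebra I) (FractionRing (reesAlgebra I)) (c • f) =
      c • algebraMap (reesAlgebra I) (FractionRing (reesAlgebra I)) f :=
  map_smul (IsScalarTower.toAlgHom A (reesAlgebra I) (FractionRing (reesAlgebra I))) c f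

theorem smul_cancel (I : Ideal A) {s : A} (hs : s ∈ A⁰) {x y : FractionRing (reesAlgebra I)}
    (h : s • x = s • y) : x = y := by
  rw [Algebra.smul_def, Algebra.smul_def] at h
  exact (isUnit_algebraMap I hs).mul_left_cancel h

/-- The degree `d` part of the normalization of `A[It]`: the elements `x` that become an element
`r t ^ d` of degree `d` of `A[It]` after multiplication by some nonzerodivisor of `A`. -/
def normalizedReesGrading (I : Ideal A) (d : ℕ) : Submodule A (NormalizedRees I) where
  carrier := {x | ∃ s ∈ A⁰, ∃ r : ↥(I ^ d),
    s • (x : FractionRing (reesAlgebra I)) = algebraMap (reesAlgebra I) _ (reesMonomial I d r)}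
  zero_mem' := ⟨1, one_mem _, 0, by simp⟩
  add_mem' := by
    rintro x y ⟨s, hs, r, hx⟩ ⟨s', hs', r', hy⟩
    refine ⟨s * s', mul_mem hs hs', s' • r + s • r', ?_⟩
    rw [map_add (reesMonomial I d), map_smul (reesMonomial I d), map_smul (reesMonomial I d),
      map_add (algebraMap (reesAlgebra I) (FractionRing (reesAlgebra I))), algebraMap_smul_eq, algebraMap_smul_eq,
      ← hx, ← hy]
    simp only [Subalgebra.coe_add, smul_add, smul_smul]
    rw [mul_comm s' s]
  smul_mem' := by
    rintro c x ⟨s, hs, r, hx⟩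
    refine ⟨s, hs, c • r, ?_⟩
    rw [map_smul, algebraMap_smul_eq, ← hx, smul_comm c s]
    rfl

/-- The inclusion of `A[It]` in its normalization preserves degrees. -/
theorem reesMonomial_mem_grading (I : Ideal A) (d : ℕ) (r : ↥(I ^ d)) :
    algebraMap (reesAlgebra I) (NormalizedRees I) (reesMonomial I d r) ∈
      normalizedReesGrading I d :=
  ⟨1, one_mem _, r, one_smul A _⟩

instance normalizedRees_gradedMonoid (I : Ideal A) : SetLike.GradedMonoid (normalizedReesGrading I) where
  one_mem := ⟨1, one_mem _, ⟨1, by simp⟩, by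
    have : reesMonomial I 0 ⟨1, by simp⟩ = 1 := Subtype.ext (by simp [reesMonomial])
    rw [this]; simp⟩
  mul_mem := by
    rintro i j x y ⟨s, hs, r, hx⟩ ⟨s', hs', r', hy⟩
    refine ⟨s * s', mul_mem hs hs', ⟨r * r', by rw [pow_add]; exact Ideal.mul_mem_mul r.2 r'.2⟩, ?_⟩
    have : reesMonomial I (i + j) ⟨r * r', by rw [pow_add]; exact Ideal.mul_mem_mul r.2 r'.2⟩ =
      reesMonomial I i r * reesMonomial I j r' :=
        Subtype.ext (by simp [reesMonomial, monomial_mul_monomial])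
    rw [this, map_mul, ← hx, ← hy]
    simp only [Subalgebra.coe_mul, smul_mul_smul_comm]

/-- There is a ring homomorphism `A[It] → A[It][u]` sending `r t ^ d` to `r t ^ d u ^ d`. -/
theorem exists_gradingHom (I : Ideal A) : ∃ φ : reesAlgebra I →+* (reesAlgebra I)[X],
    ∀ (f : reesAlgebra I) (n : ℕ), ((φ f).coeff n : A[X]) = monomial n ((f : A[X]).coeff n) := by
  let ψ : A[X] →+* A[X][X] := eval₂RingHom (C.comp C) (C X * X)
  have hψ : ∀ f n, (ψ f).coeff n = monomial n (f.coeff n) := by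
    intro f n
    induction f using Polynomial.induction_on' with
    | add p q hp hq => simp [hp, hq]
    | monomial k a =>
      simp only [ψ, coe_eval₂RingHom, eval₂_monomial, RingHom.coe_comp, Function.comp_apply, mul_pow,
        ← C_pow, ← mul_assoc, ← C_mul, coeff_C_mul_X_pow, coeff_monomial]
      split_ifs with h h' h'
      · subst h; rw [C_mul_X_pow_eq_monomial]
      · exact absurd h.symm h'
      · exact absurd h'.symm h
      · simp
  let ι : (reesAlgebra I)[X] →+* A[X][X] := mapRingHom (reesAlgebra I).val.toRingHom
  have hι : Function.Injective ι := map_injective _ Subtype.val_injective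
  have hex : ∀ f : reesAlgebra I, ∃ g, ι g = ψ f := by
    intro f
    have : ψ f ∈ lifts (reesAlgebra I).val.toRingHom := by
      rw [lifts_iff_coeff_lifts]
      intro n
      rw [hψ]
      exact ⟨⟨monomial n ((f : A[X]).coeff n), reesAlgebra.monomial_mem.2 (f.2 n)⟩, rfl⟩
    obtain ⟨g, hg⟩ := (mem_lifts _).1 this
    exact ⟨g, hg⟩
  choose φ hφ using hex
  refine ⟨⟨⟨⟨φ, ?_⟩, ?_⟩, ?_, ?_⟩, ?_⟩
  · apply hι; simp [hφ]
  · intro x y; apply hι; simp [hφ]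
  · apply hι; simp [hφ]
  · intro x y; apply hι; simp [hφ]
  · intro f n
    have := congrArg (fun p => coeff p n) (hφ f)
    simp only [ι, coe_mapRingHom, coeff_map, hψ] at this
    exact this

/-- The homogeneous components of an integral element with a denominator in `A` are integral. -/
theorem isIntegral_component (I : Ideal A) {s : A} (hs : s ∈ A⁰)
    {x : FractionRing (reesAlgebra I)} (hx : IsIntegral (reesAlgebra I) x) {f : reesAlgebra I}
    (hf : s • x = algebraMap (reesAlgebra I) _ f) (n : ℕ) :
    ∃ y : FractionRing (reesAlgebra I), IsIntegral (reesAlgebra I) y ∧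
      s • y = algebraMap (reesAlgebra I) _ (reesMonomial I n ⟨(f : A[X]).coeff n, f.2 n⟩) := by
  obtain ⟨φ, hφ⟩ := exists_gradingHom I
  obtain ⟨p, hp, hpx⟩ := hx
  obtain ⟨s', hs'⟩ : ∃ s' : (reesAlgebra I), s' = algebraMap A (reesAlgebra I) s := ⟨_, rfl⟩
  have hinj : Function.Injective (algebraMap (reesAlgebra I) (FractionRing (reesAlgebra I))) := IsFractionRing.injective (reesAlgebra I) (FractionRing (reesAlgebra I))
  have h1 : eval f (scaleRoots p s') = 0 := by
    apply hinj
    rw [map_zero, ← eval₂_at_apply, ← hf, Algebra.smul_def, IsScalarTower.algebraMap_apply A (reesAlgebra I) (FractionRing (reesAlgebra I)), ← hs']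
    exact scaleRoots_eval₂_eq_zero _ hpx
  have hφs : φ s' = C s' := by
    ext1 n
    apply Subtype.ext
    rw [hφ, coeff_C]
    by_cases h : n = 0
    · subst h
      simp [hs']
    · have : ((s' : (reesAlgebra I)) : A[X]) = C s := by rw [hs']; rfl
      simp [h, this, coeff_C]
  obtain ⟨v, hv⟩ := isUnit_algebraMap I hs
  let Φ : (reesAlgebra I) →+* (FractionRing (reesAlgebra I))[X] := (mapRingHom (algebraMap (reesAlgebra I) (FractionRing (reesAlgebra I)))).comp φ
  have hΦs : Φ s' = C (v : (FractionRing (reesAlgebra I))) := by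
    simp only [Φ, RingHom.comp_apply, hφs, coe_mapRingHom, map_C, hv]
    rw [IsScalarTower.algebraMap_apply A (reesAlgebra I) (FractionRing (reesAlgebra I)), ← hs']
  let z : (FractionRing (reesAlgebra I))[X] := C (↑v⁻¹ : (FractionRing (reesAlgebra I))) * Φ f
  have hz : Φ s' * z = Φ f := by
    rw [hΦs, ← mul_assoc, ← C_mul]; simp
  have h2 : eval₂ Φ z p = 0 := by
    have h3 : eval₂ Φ (Φ s' * z) (scaleRoots p s') = 0 := by
      rw [hz, eval₂_at_apply, h1, map_zero]
    rw [scaleRoots_eval₂_mul] at h3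
    have hu : IsUnit (Φ s') := by rw [hΦs]; exact (v.isUnit).map C
    exact ((hu.pow _).mul_right_eq_zero).1 h3
  let _ : Algebra (reesAlgebra I)[X] (FractionRing (reesAlgebra I))[X] := Polynomial.algebra (reesAlgebra I) (FractionRing (reesAlgebra I))
  have hzint : IsIntegral (reesAlgebra I)[X] z := by
    refine ⟨p.map φ, hp.map φ, ?_⟩
    rw [eval₂_map]
    exact h2
  refine ⟨z.coeff n, Polynomial.isIntegral_iff_isIntegral_coeff.1 hzint n, ?_⟩
  have : (φ f).coeff n = reesMonomial I n ⟨(f : A[X]).coeff n, f.2 n⟩ := Subtype.ext (hφ f n)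
  rw [Algebra.smul_def, ← hv, coeff_C_mul, ← mul_assoc, v.mul_inv, one_mul]
  simp only [Φ, RingHom.comp_apply, coe_mapRingHom, coeff_map, this]

theorem eq_zero_of_forall_mem [IsReduced A] {a : A} (h : ∀ P ∈ minimalPrimes A, a ∈ P) :
    a = 0 := by
  have h1 : a ∈ sInf (minimalPrimes A) := by
    rw [Submodule.mem_sInf]; exact h
  rw [minimalPrimes, Ideal.sInf_minimalPrimes] at h1
  exact (mem_nilradical.1 h1).eq_zero

theorem exists_separating [IsNoetherianRing A] {P : Ideal A} (hP : P ∈ minimalPrimes A) :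
    ∃ e ∉ P, ∀ P' ∈ minimalPrimes A, P' ≠ P → e ∈ P' := by
  classical
  have hfin := minimalPrimes.finite_of_isNoetherianRing A
  have hprime : P.IsPrime := hP.1.1
  have h1 : ¬ (hfin.toFinset.erase P).inf id ≤ P := by
    intro h
    obtain ⟨P', hP', hle⟩ := (Ideal.IsPrime.inf_le' hprime).1 h
    rw [Finset.mem_erase, Set.Finite.mem_toFinset] at hP'
    exact hP'.1 (le_antisymm hle (hP.2 hP'.2.1 hle))
  obtain ⟨e, he, heP⟩ := SetLike.not_le_iff_exists.1 h1
  refine ⟨e, heP, fun P' hP' hne => ?_⟩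
  rw [Submodule.mem_finsetInf] at he
  exact he P' (by simp [hne, hP'])

/-- A nonzerodivisor of `A[It]` is nonzero modulo each minimal prime of `A`. -/
theorem exists_coeff_notMem [IsNoetherianRing A] [IsReduced A] {I : Ideal A}
    {g : reesAlgebra I} (hg : g ∈ (reesAlgebra I)⁰) {P : Ideal A} (hP : P ∈ minimalPrimes A) :
    ∃ n, (g : A[X]).coeff n ∉ P := by
  by_contra! h
  obtain ⟨e, heP, he⟩ := exists_separating hP
  apply heP
  have h1 : C e * (g : A[X]) = 0 := by
    ext n
    rw [coeff_C_mul, coeff_zero]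
    apply eq_zero_of_forall_mem
    intro P' hP'
    by_cases hne : P' = P
    · subst hne; exact Ideal.mul_mem_left _ _ (h n)
    · exact Ideal.mul_mem_right _ _ (he P' hP' hne)
  have h2 := (mem_nonZeroDivisors_iff.1 (reesAlgebra_nonZeroDivisors hg)).2 _ h1
  rw [C_eq_zero.1 h2]
  exact zero_mem P

theorem exists_denominator_at [IsNoetherianRing A] [IsReduced A] (I : Ideal A)
    {x : FractionRing (reesAlgebra I)} (hx : IsIntegral (reesAlgebra I) x)
    {f g : reesAlgebra I} (hg : g ∈ (reesAlgebra I)⁰)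
    (hfg : x * algebraMap (reesAlgebra I) _ g = algebraMap (reesAlgebra I) _ f)
    {P : Ideal A} (hP : P ∈ minimalPrimes A) :
    ∃ s ∉ P, ∃ h : reesAlgebra I, ∀ n,
      s * (f : A[X]).coeff n - ((h * g : reesAlgebra I) : A[X]).coeff n ∈ P := by
  have hprime : P.IsPrime := hP.1.1
  by_cases hIP : I ≤ P
  · have hpos : ∀ (k : reesAlgebra I) (n : ℕ), n ≠ 0 → (k : A[X]).coeff n ∈ P := fun k n hn =>
      hIP (Ideal.pow_le_self hn (k.2 n))
    refine ⟨(g : A[X]).coeff 0, ?_, algebraMap A _ ((f : A[X]).coeff 0), ?_⟩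
    · intro h0
      obtain ⟨n, hn⟩ := exists_coeff_notMem hg hP
      by_cases h : n = 0
      · subst h; exact hn h0
      · exact hn (hpos g n h)
    · intro n
      have : ((algebraMap A (reesAlgebra I) ((f : A[X]).coeff 0) * g : reesAlgebra I) : A[X]) =
        C ((f : A[X]).coeff 0) * g := rfl
      rw [this, coeff_C_mul]
      by_cases h : n = 0
      · subst h; rw [mul_comm, sub_self]; exact zero_mem P
      · exact sub_mem (Ideal.mul_mem_left _ _ (hpos f n h)) (Ideal.mul_mem_left _ _ (hpos g n h))
  · obtain ⟨b, hbI, hbP⟩ := SetLike.not_le_iff_exists.1 hIP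
    let K := FractionRing (A ⧸ P)
    have hker : ∀ a : A, algebraMap A K a = 0 ↔ a ∈ P := by
      intro a
      rw [IsScalarTower.algebraMap_apply A (A ⧸ P) K,
        FaithfulSMul.algebraMap_eq_zero_iff, Ideal.Quotient.algebraMap_eq,
        Ideal.Quotient.eq_zero_iff_mem]
    let μ : reesAlgebra I →+* K[X] :=
      (mapRingHom (algebraMap A K)).comp (reesAlgebra I).val.toRingHom
    have hμ : ∀ (k : reesAlgebra I) (n : ℕ), (μ k).coeff n = algebraMap A K ((k : A[X]).coeff n) :=
      fun k n => coeff_map _ _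
    let L := FractionRing K[X]
    have hunit : ∀ y : (reesAlgebra I)⁰, IsUnit (((algebraMap K[X] L).comp μ) y) := by
      rintro ⟨y, hy⟩
      obtain ⟨n, hn⟩ := exists_coeff_notMem hy hP
      rw [isUnit_iff_ne_zero, RingHom.comp_apply, Ne, FaithfulSMul.algebraMap_eq_zero_iff]
      intro h0
      apply hn
      rw [← hker, ← hμ]
      simp [h0]
    let ν : FractionRing (reesAlgebra I) →+* L := IsLocalization.lift hunit
    have hν : ∀ k : reesAlgebra I, ν (algebraMap _ _ k) = algebraMap K[X] L (μ k) := fun k =>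
      IsLocalization.lift_eq hunit k
    have hint : IsIntegral K[X] (ν x) := by
      obtain ⟨p, hp, hpx⟩ := hx
      refine ⟨p.map μ, hp.map μ, ?_⟩
      rw [eval₂_map]
      have : (algebraMap K[X] L).comp μ = ν.comp (algebraMap _ _) := by
        ext k; exact (hν k).symm
      rw [this, ← hom_eval₂, hpx, map_zero]
    obtain ⟨w, hw⟩ := IsIntegrallyClosed.isIntegral_iff.1 hint
    have hwg : w * μ g = μ f := by
      apply FaithfulSMul.algebraMap_injective K[X] L
      rw [map_mul, hw, ← hν, ← hν, ← map_mul, hfg]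
    obtain ⟨d, hd0, hd⟩ := IsLocalization.integerNormalization_spec (A ⧸ P)⁰ w
    obtain ⟨s₀, hs₀⟩ := Ideal.Quotient.mk_surjective d
    obtain ⟨q, hq⟩ := map_surjective _ (Ideal.Quotient.mk_surjective (I := P))
      (IsLocalization.integerNormalization (A ⧸ P)⁰ w)
    have hs₀P : s₀ ∉ P := by
      rw [← Ideal.Quotient.eq_zero_iff_mem, hs₀]
      exact nonZeroDivisors.ne_zero hd0
    have hqR : C (b ^ q.natDegree) * q ∈ reesAlgebra I := by
      intro n
      rw [coeff_C_mul]
      by_cases hn : n ≤ q.natDegree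
      · exact Ideal.mul_mem_right _ _ (Ideal.pow_le_pow_right hn (Ideal.pow_mem_pow hbI _))
      · rw [coeff_eq_zero_of_natDegree_lt (not_le.1 hn), mul_zero]
        exact zero_mem _
    refine ⟨b ^ q.natDegree * s₀, ?_, ⟨_, hqR⟩, ?_⟩
    · intro h
      rcases hprime.mem_or_mem h with h | h
      · exact hbP (hprime.mem_of_pow_mem _ h)
      · exact hs₀P h
    · have hqw : (q.map (algebraMap A K)) = C (algebraMap A K s₀) * w := by
        ext n
        rw [coeff_map, coeff_C_mul, IsScalarTower.algebraMap_apply A (A ⧸ P) K,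
          IsScalarTower.algebraMap_apply A (A ⧸ P) K, Ideal.Quotient.algebraMap_eq, hs₀,
          ← Ideal.Quotient.algebraMap_eq, ← coeff_map,
          Ideal.Quotient.algebraMap_eq, hq, ← coeff_map, hd, coeff_smul, Algebra.smul_def]
      have hmain : μ (⟨_, hqR⟩ * g) = C (algebraMap A K (b ^ q.natDegree * s₀)) * μ f := by
        have : μ ⟨_, hqR⟩ = C (algebraMap A K (b ^ q.natDegree)) * q.map (algebraMap A K) := by
          change (C (b ^ q.natDegree) * q).map (algebraMap A K) = _
          rw [Polynomial.map_mul, map_C]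
        rw [map_mul, this, hqw, ← hwg, map_mul (algebraMap A K), C_mul]
        ring
      intro n
      rw [← hker, map_sub, map_mul, ← hμ, ← hμ, hmain, coeff_C_mul, sub_self]

/-- Over a reduced Noetherian ring `A`, every element of the normalization of `A[It]` has a
denominator in `A`. -/
theorem exists_denominator [IsNoetherianRing A] [IsReduced A] (I : Ideal A)
    {x : FractionRing (reesAlgebra I)} (hx : IsIntegral (reesAlgebra I) x) :
    ∃ s ∈ A⁰, ∃ f : reesAlgebra I, s • x = algebraMap (reesAlgebra I) _ f := by
  classical
  have hfin := minimalPrimes.finite_of_isNoetherianRing A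
  obtain ⟨⟨f, g, hg⟩, hfg⟩ := IsLocalization.surj (reesAlgebra I)⁰ x
  have H : ∀ P : Ideal A, ∃ (e s : A) (h : reesAlgebra I), P ∈ minimalPrimes A →
      (e ∉ P ∧ (∀ P' ∈ minimalPrimes A, P' ≠ P → e ∈ P')) ∧ s ∉ P ∧
      ∀ n, s * (f : A[X]).coeff n - ((h * g : reesAlgebra I) : A[X]).coeff n ∈ P := by
    intro P
    by_cases hP : P ∈ minimalPrimes A
    · obtain ⟨e, he⟩ := exists_separating hP
      obtain ⟨s, hs, h, hh⟩ := exists_denominator_at I hx hg hfg hP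
      exact ⟨e, s, h, fun _ => ⟨he, hs, hh⟩⟩
    · exact ⟨0, 0, 0, fun h => absurd h hP⟩
  choose e s h H using H
  refine ⟨∑ P ∈ hfin.toFinset, e P * s P, ?_, ∑ P ∈ hfin.toFinset, e P • h P, ?_⟩
  · rw [mem_nonZeroDivisors_iff_right]
    intro a ha
    apply eq_zero_of_forall_mem
    intro P hP
    have hprime : P.IsPrime := hP.1.1
    have h1 : ∑ P' ∈ hfin.toFinset.erase P, e P' * s P' ∈ P := by
      refine sum_mem fun P' hP' => ?_
      rw [Finset.mem_erase, Set.Finite.mem_toFinset] at hP'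
      exact Ideal.mul_mem_right _ _ ((H P' hP'.2).1.2 P hP (Ne.symm hP'.1))
    rw [← Finset.add_sum_erase _ _ (hfin.mem_toFinset.2 hP), mul_add] at ha
    have h2 : a * (e P * s P) ∈ P := by
      rw [eq_neg_of_add_eq_zero_left ha]
      exact neg_mem (Ideal.mul_mem_left _ _ h1)
    rcases hprime.mem_or_mem h2 with h | h
    · exact h
    · rcases hprime.mem_or_mem h with h | h
      · exact absurd h (H P hP).1.1
      · exact absurd h (H P hP).2.1
  · have key : (∑ P ∈ hfin.toFinset, e P * s P) • f = (∑ P ∈ hfin.toFinset, e P • h P) * g := by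
      rw [Finset.sum_smul, Finset.sum_mul]
      refine Finset.sum_congr rfl fun P hP => ?_
      rw [Set.Finite.mem_toFinset] at hP
      rw [mul_smul, smul_mul_assoc, ← sub_eq_zero,
        ← smul_sub (e P) (s P • f) (h P * g)]
      apply Subtype.ext
      ext n
      have : (((e P • (s P • f - h P * g) : reesAlgebra I) : A[X])).coeff n =
        e P * (s P * (f : A[X]).coeff n - ((h P * g : reesAlgebra I) : A[X]).coeff n) := by
        simp
      rw [this]
      simp only [ZeroMemClass.coe_zero, coeff_zero]
      apply eq_zero_of_forall_mem
      intro P' hP'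
      by_cases hne : P' = P
      · subst hne; exact Ideal.mul_mem_left _ _ ((H P' hP').2.2 n)
      · exact Ideal.mul_mem_right _ _ ((H P hP).1.2 P' hP' hne)
    apply (IsLocalization.map_units (M := (reesAlgebra I)⁰)
      (FractionRing (reesAlgebra I)) ⟨g, hg⟩).mul_right_cancel
    change _ * algebraMap _ _ g = _ * algebraMap _ _ g
    rw [smul_mul_assoc, ← map_mul, ← key, algebraMap_smul_eq]
    exact congrArg _ hfg

theorem normalizedReesGrading_injective (I : Ideal A) :
    Function.Injective (DirectSum.coeAddMonoidHom (normalizedReesGrading I)) := by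
    classical
    rw [injective_iff_map_eq_zero]
    intro y hy
    have H : ∀ d, ∃ s ∈ A⁰, ∃ r : ↥(I ^ d), s • ((y d : NormalizedRees I) :
      FractionRing (reesAlgebra I)) = algebraMap (reesAlgebra I) _ (reesMonomial I d r) :=
      fun d => (y d).2
    choose s hs r hr using H
    let σ : A := ∏ d ∈ y.support, s d
    have hσ : σ ∈ A⁰ := prod_mem fun d _ => hs d
    let ρ : ∀ d, ↥(I ^ d) := fun d => (∏ k ∈ y.support.erase d, s k) • r d
    have hρ : ∀ d ∈ y.support, σ • ((y d : NormalizedRees I) : FractionRing (reesAlgebra I)) =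
        algebraMap (reesAlgebra I) _ (reesMonomial I d (ρ d)) := by
      intro d hd
      simp only [σ, ρ, map_smul, algebraMap_smul_eq]
      rw [← Finset.prod_erase_mul _ _ hd, mul_smul, hr]
    have hsum : ∑ d ∈ y.support, reesMonomial I d (ρ d) = 0 := by
      apply IsFractionRing.injective (reesAlgebra I) (FractionRing (reesAlgebra I))
      rw [map_zero, map_sum, ← Finset.sum_congr rfl hρ, ← Finset.smul_sum]
      rw [DirectSum.coeAddMonoidHom_eq_dfinsuppSum, DFinsupp.sum] at hy
      have := congrArg (Subalgebra.val _) hy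
      rw [map_sum, map_zero] at this
      have h2 : ∑ d ∈ y.support, ((y d : NormalizedRees I) : FractionRing (reesAlgebra I)) = 0 :=
        this
      rw [h2, smul_zero]
    ext1 d
    by_cases hd : d ∈ y.support
    · have h0 : reesMonomial I d (ρ d) = 0 := by
        apply Subtype.ext
        have h3 := congrArg (fun p : reesAlgebra I => (p : A[X]).coeff d) hsum
        simp only [AddSubmonoidClass.coe_finsetSum, finsetSum_coeff] at h3
        rw [Finset.sum_eq_single_of_mem d hd] at h3
        · have h4 : (ρ d : A) = 0 := by simpa [reesMonomial] using h3
          simp [reesMonomial, h4]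
        · intro k _ hk
          simp [reesMonomial, coeff_monomial, hk]
      have h5 : ((y d : NormalizedRees I) : FractionRing (reesAlgebra I)) = 0 :=
        smul_cancel I hσ (by rw [hρ d hd, h0, map_zero, smul_zero])
      exact Subtype.ext (Subtype.ext h5)
    · exact DFinsupp.notMem_support_iff.1 hd

theorem normalizedReesGrading_surjective [IsNoetherianRing A] [IsReduced A] (I : Ideal A) :
    Function.Surjective (DirectSum.coeAddMonoidHom (normalizedReesGrading I)) := by
    intro x
    obtain ⟨s, hs, f, hf⟩ := exists_denominator I x.2
    choose y hy hy' using fun n => isIntegral_component I hs x.2 hf n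
    refine ⟨∑ d ∈ (f : A[X]).support,
      DirectSum.of (fun d => normalizedReesGrading I d) d ⟨⟨y d, hy d⟩, s, hs, _, hy' d⟩, ?_⟩
    rw [map_sum]
    simp only [DirectSum.coeAddMonoidHom_of]
    apply Subtype.ext
    apply smul_cancel I hs
    rw [hf, AddSubmonoidClass.coe_finsetSum, Finset.smul_sum]
    simp only [hy']
    rw [← map_sum]
    congr 1
    apply Subtype.ext
    rw [AddSubmonoidClass.coe_finsetSum]
    exact ((f : A[X]).as_sum_support).symm

/-- For reduced Noetherian `A`, the pieces above make the normalization of `A[It]` an `ℕ`-graded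
`A`-algebra. -/
instance normalizedRees_gradedAlgebra [IsNoetherianRing A] [IsReduced A] (I : Ideal A) :
    GradedAlgebra (normalizedReesGrading I) where
  toDecomposition := DirectSum.IsInternal.chooseDecomposition _
    ⟨normalizedReesGrading_injective I, normalizedReesGrading_surjective I⟩

/-- The integral closure of the ideal `I`: all `a` with an equation
`a ^ n + c₁ a ^ (n - 1) + ⋯ + cₙ = 0`, where `n ≥ 1` and `cᵢ ∈ I ^ i`. -/
def idealIntegralClosure (I : Ideal A) : Set A :=
  {a | ∃ n : ℕ, 0 < n ∧ ∃ c : ℕ → A, (∀ i ∈ Finset.Icc 1 n, c i ∈ I ^ i) ∧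
    a ^ n + ∑ i ∈ Finset.Icc 1 n, c i * a ^ (n - i) = 0}

variable [IsNoetherianRing A] [IsReduced A]

/-- `Proj S` for `S` the normalization of `A[It]`. -/
abbrev ProjNormalizedRees (I : Ideal A) : Type _ :=
  ProjectiveSpectrum (normalizedReesGrading I)

/-- The contraction `q ∩ A` of a point `q` of `Proj S`. -/
def contraction {I : Ideal A} (q : ProjNormalizedRees I) : Ideal A :=
  q.asHomogeneousIdeal.toIdeal.comap (algebraMap A (NormalizedRees I))

/-- The ring `S_(q)`: the degree zero part of the localization of `S` at the homogeneous elements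
outside `q`. -/
abbrev DegreeZeroLocalization {I : Ideal A} (q : ProjNormalizedRees I) : Type _ :=
  HomogeneousLocalization.AtPrime (normalizedReesGrading I) q.asHomogeneousIdeal.toIdeal

/-- The natural homomorphism `A → S₀ → S_(q)`. -/
def toDegreeZeroLocalization {I : Ideal A} (q : ProjNormalizedRees I) :
    A →+* DegreeZeroLocalization q :=
  (HomogeneousLocalization.fromZeroRingHom (normalizedReesGrading I) _).comp
    (algebraMap A (normalizedReesGrading I 0))

end ReesNormalization

end

open ReesNormalization

/-! Write `R = A[It]` and let `S` be its normalization.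

If `a` is integral over `I`, some nonzerodivisor `s` satisfies `s a ∈ I`, so `a t = (s a t)/s` makes
sense as a fraction. The equation of `a`, homogenized, shows that it lies in `S`
(`exists_degree_one`). A point `q` of `Proj S` misses some `b t` with `b ∈ I`, since modulo a
homogeneous prime containing `I t` every element of positive degree of `S` is nilpotent
(`exists_degree_one_notMem`). Then `a = (a t / b t) b` in `S_(q)`.

Conversely, it suffices to find an integral equation of `a` modulo each minimal prime `P`: there are
finitely many, the equations multiply, and `A` is reduced. For `a ∉ P`, work in `K = Frac(A/P)`.
Either the subring `A[I/a]` yields an equation, or some valuation ring `V` dominates `A` with `I/a`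
in its maximal ideal (`exists_equation_or_valuationSubring`). In the second case `I V = b V`, and `r
t^d ↦ (r/b^d) X^d` extends to a graded map `S → V[X]`. The kernel of its reduction to the residue
field is a point of `Proj S` over the closed point. There (*) forces `b ∣ a` in `V`
(`dvd_of_forall_mem_map`), against `b/a` being a nonunit. -/

namespace ReesNormalization

/-! ### Integrality in graded rings and homogeneous localization. -/

section Generic

/-- An element that becomes a root of a scaled monic polynomial after multiplication by a
denominator is integral. -/
theorem isIntegral_of_scaled {R L : Type*} [CommRing R] [CommRing L] [Algebra R L] {x : L}
    {s m : R} (hs : IsUnit (algebraMap R L s)) (hx : algebraMap R L s * x = algebraMap R L m)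
    {n : ℕ} {c : ℕ → R}
    (h : m ^ n + ∑ i ∈ Finset.Icc 1 n, s ^ i * c i * m ^ (n - i) = 0) : IsIntegral R x := by
  let p : R[X] := X ^ n + ∑ i ∈ Finset.Icc 1 n, C (c i) * X ^ (n - i)
  have hp : p.Monic := by
    apply monic_X_pow_add
    refine lt_of_le_of_lt (degree_sum_le _ _) ((Finset.sup_lt_iff ?_).2 fun i hi => ?_)
    · exact WithBot.bot_lt_coe n
    · refine lt_of_le_of_lt (degree_C_mul_X_pow_le _ _) ?_
      rw [Finset.mem_Icc] at hi
      exact_mod_cast (by omega : n - i < n)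
  -- Since `m = s x`, the given relation is `s ^ n` times the value of `p` at `x`.
  refine ⟨p, hp, (hs.pow n).mul_right_eq_zero.1 ?_⟩
  have h' := congrArg (algebraMap R L) h
  simp only [map_zero, map_add, map_sum, map_mul, map_pow, ← hx] at h'
  rw [← h']
  simp only [p, eval₂_add, eval₂_pow, eval₂_X, eval₂_finsetSum, eval₂_mul, eval₂_C]
  rw [mul_add, mul_pow, Finset.mul_sum]
  congr 1
  refine Finset.sum_congr rfl fun i hi => ?_
  obtain ⟨k, rfl⟩ := Nat.exists_eq_add_of_le (Finset.mem_Icc.1 hi).2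
  rw [Nat.add_sub_cancel_left]
  ring

variable {A S : Type*} [CommRing A] [CommRing S] [Algebra A S] (𝒜 : ℕ → Submodule A S)
  [GradedAlgebra 𝒜]

/-- A homogeneous element of positive degree that satisfies a monic equation with coefficients of
degree zero modulo a homogeneous prime ideal lies in this ideal. -/
theorem mem_of_monic_sum_mem {q : Ideal S} (hq : q.IsPrime) (hq' : q.IsHomogeneous 𝒜) {d : ℕ}
    (hd : 0 < d) {y : S} (hy : y ∈ 𝒜 d) {n : ℕ} {c : ℕ → A} (hc : c n = 1)
    (h : ∑ i ∈ Finset.range (n + 1), c i • y ^ i ∈ q) : y ∈ q := by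
  -- The `i`-th term has degree `i d` and `d > 0`, so the component of degree `n d` is just `y ^ n`.
  have h2 := hq' (n * d) h
  rw [DirectSum.decompose_sum, DFinsupp.finsetSum_apply, AddSubmonoidClass.coe_finsetSum,
    Finset.sum_range_succ, Finset.sum_eq_zero, zero_add] at h2
  · have hy' : c n • y ^ n ∈ 𝒜 (n * d) := Submodule.smul_mem _ _ (SetLike.pow_mem_graded _ hy)
    rw [DirectSum.decompose_of_mem_same _ hy', hc, one_smul] at h2
    exact hq.mem_of_pow_mem _ h2
  · intro i hi
    have hy' : c i • y ^ i ∈ 𝒜 (i * d) := Submodule.smul_mem _ _ (SetLike.pow_mem_graded _ hy)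
    refine DirectSum.decompose_of_mem_ne _ hy' fun h => ?_
    have := Nat.eq_of_mul_eq_mul_right hd h
    simp at hi
    omega

/-- If the elements of a subring `R` are congruent to elements of degree zero modulo a homogeneous
prime ideal, then all homogeneous elements of positive degree integral over `R` lie in it. -/
theorem mem_of_isIntegral {R : Type*} [CommRing R] [Algebra A R] [Algebra R S]
    [IsScalarTower A R S] {q : Ideal S} (hq : q.IsPrime) (hq' : q.IsHomogeneous 𝒜)
    {γ : R → A} (hγ1 : γ 1 = 1) (hγ : ∀ f, f - algebraMap A R (γ f) ∈ q.comap (algebraMap R S))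
    {d : ℕ} (hd : 0 < d) {y : S} (hy : y ∈ 𝒜 d) (hint : IsIntegral R y) : y ∈ q := by
  obtain ⟨p, hp, hpy⟩ := hint
  refine mem_of_monic_sum_mem 𝒜 hq hq' hd hy (n := p.natDegree)
    (c := fun i => γ (p.coeff i)) (by rw [hp.coeff_natDegree, hγ1]) ?_
  rw [eval₂_eq_sum_range] at hpy
  -- Comparing with `p(y) = 0` termwise leaves multiples of `f - γ f`, which lie in `q`.
  rw [← neg_mem_iff, ← zero_sub, ← hpy, ← Finset.sum_sub_distrib]
  refine sum_mem fun i _ => ?_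
  rw [Algebra.smul_def, ← sub_mul, IsScalarTower.algebraMap_apply A R, ← map_sub]
  exact Ideal.mul_mem_right _ _ (hγ _)

theorem smul_mul_algebraMap_eq {x m m' : S} {s a b : A} (hx : s • x = m')
    (h : b • m' = (s * a) • m) :
    s • (m * algebraMap A S a) = s • (algebraMap A S b * x) := by
  rw [← hx] at h
  simp only [Algebra.smul_def, map_mul] at h ⊢
  linear_combination -h

variable (q : Ideal S) [q.IsPrime]

theorem val_fromZero_algebraMap (c : A) :
    ((HomogeneousLocalization.fromZeroRingHom 𝒜 q.primeCompl).comp (algebraMap A (𝒜 0)) c).val =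
      algebraMap S (Localization q.primeCompl) (algebraMap A S c) := by
  change Localization.mk _ _ = _
  exact Localization.mk_one_eq_algebraMap _

theorem fromZero_algebraMap_eq_mul {a b : A} {d : ℕ} {x y : S} (hx : x ∈ 𝒜 d) (hy : y ∈ 𝒜 d)
    (hyq : y ∉ q) (h : y * algebraMap A S a = algebraMap A S b * x) :
    (HomogeneousLocalization.fromZeroRingHom 𝒜 q.primeCompl).comp (algebraMap A (𝒜 0)) a =
      HomogeneousLocalization.mk ⟨d, ⟨x, hx⟩, ⟨y, hy⟩, hyq⟩ *
      (HomogeneousLocalization.fromZeroRingHom 𝒜 q.primeCompl).comp (algebraMap A (𝒜 0)) b := by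
  apply HomogeneousLocalization.val_injective
  rw [HomogeneousLocalization.val_mul, val_fromZero_algebraMap,
    val_fromZero_algebraMap, HomogeneousLocalization.val_mk]
  change _ = Localization.mk x ⟨y, hyq⟩ * _
  rw [Localization.mk_eq_mk', mul_comm, IsLocalization.mul_mk'_eq_mk'_of_mul,
    IsLocalization.eq_mk'_iff_mul_eq, ← map_mul, mul_comm, h]

/-- Passing to the full localization at `q` loses nothing needed here, and denominators can be
cleared there. -/
theorem exists_mul_mem_map {a : A} {I : Ideal A}
    (h : (HomogeneousLocalization.fromZeroRingHom 𝒜 q.primeCompl).comp (algebraMap A (𝒜 0)) a ∈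
      I.map ((HomogeneousLocalization.fromZeroRingHom 𝒜 q.primeCompl).comp
        (algebraMap A (𝒜 0)))) :
    ∃ y ∉ q, y * algebraMap A S a ∈ I.map (algebraMap A S) := by
  have h1 := Ideal.mem_map_of_mem
    (algebraMap (HomogeneousLocalization 𝒜 q.primeCompl) (Localization q.primeCompl)) h
  rw [Ideal.map_map] at h1
  have h2 : (algebraMap (HomogeneousLocalization 𝒜 q.primeCompl)
      (Localization q.primeCompl)).comp
      ((HomogeneousLocalization.fromZeroRingHom 𝒜 q.primeCompl).comp (algebraMap A (𝒜 0))) =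
      (algebraMap S (Localization q.primeCompl)).comp (algebraMap A S) :=
    RingHom.ext fun c => val_fromZero_algebraMap 𝒜 q c
  rw [← RingHom.comp_apply, h2, ← Ideal.map_map, RingHom.comp_apply,
    IsLocalization.algebraMap_mem_map_algebraMap_iff q.primeCompl] at h1
  obtain ⟨y, hy, hy'⟩ := h1
  exact ⟨y, hy, hy'⟩

end Generic

/-! ### Denominators, and the element `a t` of the normalization. -/

variable {A : Type*} [CommRing A]

/-- Prime avoidance gives `s ∈ J` outside the finitely many minimal primes; if `x s = 0`, then `x`
lies in all of them, hence is zero. -/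
theorem exists_mem_nonZeroDivisors [IsNoetherianRing A] [IsReduced A] {J : Ideal A}
    (hJ : ∀ P ∈ minimalPrimes A, ¬ J ≤ P) : ∃ s ∈ J, s ∈ A⁰ := by
  have hfin := minimalPrimes.finite_of_isNoetherianRing A
  have h1 : ¬ ((J : Set A) ⊆ ⋃ P ∈ (hfin.toFinset : Set (Ideal A)), ((P : Ideal A) : Set A)) := by
    rw [Ideal.subset_union_prime (f := fun P => P) ⊥ ⊥
      (fun P hP _ _ => (hfin.mem_toFinset.1 hP).1.1)]
    rintro ⟨P, hP, hle⟩
    exact hJ P (hfin.mem_toFinset.1 hP) hle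
  obtain ⟨s, hsJ, hs⟩ := Set.not_subset.1 h1
  refine ⟨s, hsJ, mem_nonZeroDivisors_iff_right.2 fun x hx => eq_zero_of_forall_mem fun P hP => ?_⟩
  refine ((hP.1.1).mem_or_mem (hx ▸ zero_mem P : x * s ∈ P)).resolve_right fun hsP => hs ?_
  exact Set.mem_biUnion (Finset.mem_coe.2 (hfin.mem_toFinset.2 hP)) hsP

/-- An element of every minimal prime containing `I` is multiplied into `I` by some
nonzerodivisor. -/
theorem exists_nonZeroDivisor_mul_mem [IsNoetherianRing A] [IsReduced A] {I : Ideal A} {a : A}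
    (ha : ∀ P ∈ minimalPrimes A, I ≤ P → a ∈ P) : ∃ s ∈ A⁰, s * a ∈ I := by
  obtain ⟨s, hs, hs'⟩ := exists_mem_nonZeroDivisors (J := I.colon (Ideal.span {a})) (by
    intro P hP hle
    by_cases hIP : I ≤ P
    · obtain ⟨e, heP, he⟩ := exists_separating hP
      refine heP (hle (Ideal.mem_colon_span_singleton.2 ?_))
      have : e * a = 0 := eq_zero_of_forall_mem fun P' hP' => by
        by_cases hne : P' = P
        · subst hne; exact Ideal.mul_mem_left _ _ (ha _ hP hIP)
        · exact Ideal.mul_mem_right _ _ (he P' hP' hne)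
      rw [this]
      exact zero_mem I
    · refine hIP (le_trans (fun b hb => ?_) hle)
      exact Ideal.mem_colon_span_singleton.2 (Ideal.mul_mem_right a I hb))
  exact ⟨s, hs', Ideal.mem_colon_span_singleton.1 hs⟩

theorem idealIntegralClosure_mem_of_le {I : Ideal A} {a : A} (ha : a ∈ idealIntegralClosure I)
    {P : Ideal A} [P.IsPrime] (hIP : I ≤ P) : a ∈ P := by
  obtain ⟨n, hn, c, hc, h⟩ := ha
  refine Ideal.IsPrime.mem_of_pow_mem ‹_› n ?_
  rw [eq_neg_of_add_eq_zero_left h]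
  refine neg_mem (sum_mem fun i hi => Ideal.mul_mem_right _ _ ?_)
  exact hIP (Ideal.pow_le_self (by have := (Finset.mem_Icc.1 hi).1; omega) (hc i hi))

theorem reesMonomial_mul (I : Ideal A) {i j : ℕ} (r : ↥(I ^ i)) (r' : ↥(I ^ j)) :
    reesMonomial I i r * reesMonomial I j r' =
      reesMonomial I (i + j) ⟨r * r', by rw [pow_add]; exact Ideal.mul_mem_mul r.2 r'.2⟩ :=
  Subtype.ext (by simp [reesMonomial, monomial_mul_monomial])

/-- This is the equation of `a` multiplied by `(s X) ^ n`; the coefficients become `c i X ^ i`,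
which lie in the Rees algebra when `c i ∈ I ^ i`. -/
theorem scaled_equation_polynomial {n : ℕ} {c : ℕ → A} {a : A} (s : A)
    (h : a ^ n + ∑ i ∈ Finset.Icc 1 n, c i * a ^ (n - i) = 0) :
    (C s * C a * X) ^ n + ∑ i ∈ Finset.Icc 1 n,
      C s ^ i * (C (c i) * X ^ i) * (C s * C a * X) ^ (n - i) = 0 := by
  have h' := congrArg (fun z => C s ^ n * X ^ n * C z) h
  simp only [C_0, mul_zero] at h'
  rw [← h', C_add, mul_add, map_sum, Finset.mul_sum]
  congr 1
  · rw [C_pow]; ring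
  · refine Finset.sum_congr rfl fun i hi => ?_
    rw [C_mul, C_pow]
    obtain ⟨k, rfl⟩ := Nat.exists_eq_add_of_le (Finset.mem_Icc.1 hi).2
    rw [Nat.add_sub_cancel_left]
    ring

theorem exists_scaled_equation {I : Ideal A} {a s : A} (ha : a ∈ idealIntegralClosure I)
    (hsa : s * a ∈ I ^ 1) : ∃ (n : ℕ) (c : ℕ → reesAlgebra I),
      (reesMonomial I 1 ⟨s * a, hsa⟩) ^ n + ∑ i ∈ Finset.Icc 1 n,
        algebraMap A (reesAlgebra I) s ^ i * c i *
          (reesMonomial I 1 ⟨s * a, hsa⟩) ^ (n - i) = 0 := by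
  classical
  obtain ⟨n, hn, c, hc, h⟩ := ha
  let c' : ℕ → reesAlgebra I := fun i =>
    if hi : i ∈ Finset.Icc 1 n then reesMonomial I i ⟨c i, hc i hi⟩ else 0
  refine ⟨n, c', ?_⟩
  have hm : (reesAlgebra I).val (reesMonomial I 1 ⟨s * a, hsa⟩) = C s * C a * X := by
    rw [← C_mul, C_mul_X_eq_monomial]
    rfl
  have hC : ∀ i ∈ Finset.Icc 1 n, (reesAlgebra I).val (c' i) = C (c i) * X ^ i := by
    intro i hi
    simp only [c', dif_pos hi, C_mul_X_pow_eq_monomial]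
    rfl
  have hA : (reesAlgebra I).val (algebraMap A (reesAlgebra I) s) = C s := rfl
  generalize c' = c' at hC
  generalize reesMonomial I 1 ⟨s * a, hsa⟩ = m at hm
  generalize algebraMap A (reesAlgebra I) s = s' at hA
  refine (map_eq_zero_iff (reesAlgebra I).val Subtype.val_injective).1 ?_
  rw [map_add, map_pow, map_sum, hm, ← scaled_equation_polynomial s h]
  congr 1
  refine Finset.sum_congr rfl fun i hi => ?_
  rw [map_mul, map_mul, map_pow, map_pow, hA, hm, hC i hi]

/-- If `a` is integral over `I`, then `a t` is an element of the normalization of `A[It]`. -/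
theorem exists_degree_one [IsNoetherianRing A] [IsReduced A] {I : Ideal A} {a : A}
    (ha : a ∈ idealIntegralClosure I) :
    ∃ s ∈ A⁰, ∃ (h : s * a ∈ I ^ 1) (x : NormalizedRees I),
      s • (x : FractionRing (reesAlgebra I)) =
        algebraMap (reesAlgebra I) _ (reesMonomial I 1 ⟨s * a, h⟩) := by
  obtain ⟨s, hs, hsa⟩ := exists_nonZeroDivisor_mul_mem
    (fun P hP hIP => have := hP.1.1; idealIntegralClosure_mem_of_le ha hIP)
  have hsa' : s * a ∈ I ^ 1 := by rwa [pow_one]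
  have hu := isUnit_algebraMap I hs
  rw [IsScalarTower.algebraMap_apply A (reesAlgebra I)] at hu
  obtain ⟨v, hv⟩ := hu
  -- The element `x = (s a t)/s` plays the role of `a t`.
  obtain ⟨x, hx'⟩ : ∃ x : FractionRing (reesAlgebra I), x =
    ↑v⁻¹ * algebraMap (reesAlgebra I) _ (reesMonomial I 1 ⟨s * a, hsa'⟩) := ⟨_, rfl⟩
  have hx : algebraMap (reesAlgebra I) _ (algebraMap A (reesAlgebra I) s) * x =
      algebraMap (reesAlgebra I) _ (reesMonomial I 1 ⟨s * a, hsa'⟩) := by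
    rw [← hv, hx', ← mul_assoc, Units.mul_inv, one_mul]
  obtain ⟨n, c, h⟩ := exists_scaled_equation ha hsa'
  refine ⟨s, hs, hsa', ⟨x, isIntegral_of_scaled ⟨v, hv⟩ hx h⟩, ?_⟩
  rw [Algebra.smul_def, IsScalarTower.algebraMap_apply A (reesAlgebra I)]
  exact hx

/-! ### Points of `Proj S` miss part of `I t`; integrality implies (*). -/

/-- An ideal of the normalization of `A[It]` that contains `I t` contains all elements of positive
degree of `A[It]`. -/
theorem reesMonomial_mem_of_degree_one {I : Ideal A} {q : Ideal (reesAlgebra I)}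
    (hq : ∀ b : ↥(I ^ 1), reesMonomial I 1 b ∈ q)
    (d : ℕ) (r : ↥(I ^ (d + 1))) : reesMonomial I (d + 1) r ∈ q := by
  obtain ⟨r, hr⟩ := r
  have hr' := hr
  rw [pow_succ] at hr'
  induction hr' using Submodule.mul_induction_on' with
  | mem_mul_mem m hm n hn =>
    have hn' : n ∈ I ^ 1 := by rwa [pow_one]
    have := Ideal.mul_mem_left q (reesMonomial I d ⟨m, hm⟩) (hq ⟨n, hn'⟩)
    rw [reesMonomial_mul] at this
    exact this
  | add x hx y hy ihx ihy =>
    rw [← pow_succ] at hx hy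
    have := add_mem (ihx hx) (ihy hy)
    rw [← map_add] at this
    exact this

/-- Supplies the congruence needed in `mem_of_isIntegral`, with the constant coefficient as `γ`: the
difference is a sum of terms of positive degree. -/
theorem sub_coeff_zero_mem {I : Ideal A} {q : Ideal (reesAlgebra I)}
    (hq : ∀ b : ↥(I ^ 1), reesMonomial I 1 b ∈ q) (f : reesAlgebra I) :
    f - algebraMap A _ ((f : A[X]).coeff 0) ∈ q := by
  have hf : f - algebraMap A _ ((f : A[X]).coeff 0) =
      ∑ i ∈ Finset.range (f : A[X]).natDegree,
        reesMonomial I (i + 1) ⟨(f : A[X]).coeff (i + 1), f.2 _⟩ := by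
    apply Subtype.ext
    rw [AddSubmonoidClass.coe_finsetSum]
    change (f : A[X]) - C _ = ∑ i ∈ Finset.range (f : A[X]).natDegree,
      monomial (i + 1) ((f : A[X]).coeff (i + 1))
    rw [sub_eq_iff_eq_add, ← monomial_zero_left, ← Finset.sum_range_succ'
      (fun i => monomial i ((f : A[X]).coeff i))]
    exact (f : A[X]).as_sum_range
  rw [hf]
  exact sum_mem fun i _ => reesMonomial_mem_of_degree_one hq _ _

/-- A point of `Proj` of the normalization of `A[It]` does not contain `I t`. -/
theorem exists_degree_one_notMem [IsNoetherianRing A] [IsReduced A] {I : Ideal A}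
    (q : ProjNormalizedRees I) :
    ∃ b : ↥(I ^ 1), algebraMap (reesAlgebra I) (NormalizedRees I) (reesMonomial I 1 b) ∉
      q.asHomogeneousIdeal.toIdeal := by
  by_contra! hq
  apply q.not_irrelevant_le
  rw [HomogeneousIdeal.irrelevant_le]
  intro d hd y hy
  exact mem_of_isIntegral (normalizedReesGrading I) q.isPrime q.asHomogeneousIdeal.isHomogeneous
    (γ := fun f : reesAlgebra I => (f : A[X]).coeff 0) (by simp)
    (sub_coeff_zero_mem (q := q.asHomogeneousIdeal.toIdeal.comap
      (algebraMap (reesAlgebra I) (NormalizedRees I))) hq) hd hy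
    (integralClosure.isIntegral (R := reesAlgebra I) y)

theorem toDegreeZeroLocalization_mem_map [IsNoetherianRing A] [IsReduced A] {I : Ideal A} {a : A}
    (ha : a ∈ idealIntegralClosure I) (q : ProjNormalizedRees I) :
    toDegreeZeroLocalization q a ∈ I.map (toDegreeZeroLocalization q) := by
  obtain ⟨s, hs, hsa, x, hx⟩ := exists_degree_one ha
  obtain ⟨b, hb⟩ := exists_degree_one_notMem q
  have hxd : x ∈ normalizedReesGrading I 1 := ⟨s, hs, _, hx⟩
  -- The identity `(b t) a = b (a t)`, checked after multiplication by the nonzerodivisor `s`.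
  have h : algebraMap (reesAlgebra I) (NormalizedRees I) (reesMonomial I 1 b) *
      algebraMap A _ a = algebraMap A _ (b : A) * x := by
    apply Subtype.ext
    apply smul_cancel I hs
    change s • (algebraMap (reesAlgebra I) (FractionRing (reesAlgebra I)) (reesMonomial I 1 b) *
      algebraMap A _ a) = s • (algebraMap A _ (b : A) * (x : FractionRing (reesAlgebra I)))
    refine smul_mul_algebraMap_eq hx ?_
    rw [← algebraMap_smul_eq, ← algebraMap_smul_eq, ← map_smul, ← map_smul]
    congr 2
    exact Subtype.ext (by simp [mul_comm])
  have hz := fromZero_algebraMap_eq_mul (normalizedReesGrading I) q.asHomogeneousIdeal.toIdeal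
    hxd (reesMonomial_mem_grading I 1 b) hb h
  change toDegreeZeroLocalization q a = _ * toDegreeZeroLocalization q b at hz
  rw [hz]
  refine Ideal.mul_mem_left _ _ (Ideal.mem_map_of_mem _ ?_)
  simpa using b.2

/-! ### Extending maps to the normalization; ideals in valuation rings. -/

section Generic

theorem exists_ringHom_lift {S B C : Type*} [CommRing S] [CommRing B] [CommRing C] (f : S →+* C)
    (g : B →+* C) (hg : Function.Injective g) (h : ∀ x, ∃ y, g y = f x) :
    ∃ k : S →+* B, ∀ x, g (k x) = f x := by
  choose k hk using h
  exact ⟨⟨⟨⟨k, hg (by simp [hk])⟩, fun x y => hg (by simp [hk])⟩, hg (by simp [hk]),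
    fun x y => hg (by simp [hk])⟩, hk⟩

/-- A homomorphism from a ring to an integrally closed domain that is injective on nonzerodivisors
extends to the normalization. -/
theorem exists_extension_integralClosure {R B : Type*} [CommRing R] [CommRing B] [IsDomain B]
    [IsIntegrallyClosed B] (f : R →+* B) (hf : ∀ r ∈ R⁰, f r ≠ 0) :
    ∃ g : integralClosure R (FractionRing R) →+* B, ∀ r, g (algebraMap R _ r) = f r := by
  have hinj : Function.Injective (algebraMap B (FractionRing B)) :=
    IsFractionRing.injective B (FractionRing B)
  have hunit : ∀ y : R⁰, IsUnit (((algebraMap B (FractionRing B)).comp f) y) := by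
    rintro ⟨y, hy⟩
    rw [isUnit_iff_ne_zero, RingHom.comp_apply, Ne, map_eq_zero_iff _ hinj]
    exact hf y hy
  let ν : FractionRing R →+* FractionRing B := IsLocalization.lift hunit
  have hν : ∀ k : R, ν (algebraMap _ _ k) = algebraMap B _ (f k) := fun k =>
    IsLocalization.lift_eq hunit k
  obtain ⟨g, hg⟩ := exists_ringHom_lift
    (ν.comp (algebraMap (integralClosure R (FractionRing R)) (FractionRing R)))
    (algebraMap B (FractionRing B)) hinj (by
      rintro ⟨x, hx⟩
      obtain ⟨p, hp, hpx⟩ := hx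
      -- Applying `ν` to the monic equation of `x` shows that `ν x` is integral over `B`, so it
      -- comes from `B`.
      refine IsIntegrallyClosed.isIntegral_iff.1 ⟨p.map f, hp.map f, ?_⟩
      have hcomp : (algebraMap B (FractionRing B)).comp f = ν.comp (algebraMap R _) :=
        RingHom.ext fun k => (hν k).symm
      rw [eval₂_map, hcomp]
      change eval₂ _ (ν x) p = 0
      rw [← hom_eval₂, hpx, map_zero])
  refine ⟨g, fun r => hinj ?_⟩
  rw [hg, ← hν]
  rfl

/-- Divisibility in a valuation ring is total, so one of finitely many generators divides the
others; choosing `b` in `I` itself makes `b t` available later. -/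
theorem exists_generator_of_fg {A V : Type*} [CommRing A] [CommRing V] [IsDomain V]
    [ValuationRing V] (β : A →+* V) {I : Ideal A} (hI : I.FG) :
    ∃ b ∈ I, I.map β ≤ Ideal.span {β b} := by
  classical
  obtain ⟨t, rfl⟩ := hI
  induction t using Finset.induction_on with
  | empty => exact ⟨0, zero_mem _, by
      rw [Finset.coe_empty, Ideal.span_empty, Ideal.map_bot]
      exact bot_le⟩
  | insert x t hx ih =>
    obtain ⟨b, hb, hle⟩ := ih
    change b ∈ Ideal.span _ at hb
    change Ideal.map β (Ideal.span _) ≤ _ at hle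
    change ∃ c ∈ Ideal.span _, Ideal.map β (Ideal.span _) ≤ _
    rw [Finset.coe_insert, Ideal.span_insert, Ideal.map_sup, Ideal.map_span β {x},
      Set.image_singleton]
    rcases ValuationRing.dvd_total (β b) (β x) with h | h
    · exact ⟨b, Ideal.mem_sup_right hb,
        sup_le (Ideal.span_singleton_le_span_singleton.2 h) hle⟩
    · exact ⟨x, Ideal.mem_sup_left (Ideal.mem_span_singleton_self x),
        sup_le le_rfl (hle.trans (Ideal.span_singleton_le_span_singleton.2 h))⟩

/-! ### Points of `Proj S` from graded maps `S → V[X]`. -/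

section Point

variable {A S V : Type*} [CommRing A] [CommRing S] [Algebra A S] (𝒜 : ℕ → Submodule A S)
  [GradedAlgebra 𝒜] [CommRing V] [IsLocalRing V] {β : A →+* V} {Ψ : S →+* V[X]}

/-- The kernel of the reduction of `Ψ : S → V[X]` modulo the maximal ideal of `V`. -/
noncomputable def reductionKer (Ψ : S →+* V[X]) : Ideal S :=
  RingHom.ker ((mapRingHom (IsLocalRing.residue V)).comp Ψ)

instance reductionKer_isPrime : (reductionKer Ψ).IsPrime := RingHom.ker_isPrime _

theorem mem_reductionKer {x : S} :
    x ∈ reductionKer Ψ ↔ ∀ n, (Ψ x).coeff n ∈ IsLocalRing.maximalIdeal V := by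
  rw [reductionKer, RingHom.mem_ker, RingHom.comp_apply, coe_mapRingHom, Polynomial.ext_iff]
  refine forall_congr' fun n => ?_
  rw [coeff_map, coeff_zero, IsLocalRing.residue_eq_zero_iff]

theorem reductionKer_isHomogeneous
    (hΨ : ∀ d, ∀ x ∈ 𝒜 d, ∀ n, n ≠ d → (Ψ x).coeff n = 0) :
    (reductionKer Ψ).IsHomogeneous 𝒜 := by
  classical
  intro d x hx
  rw [mem_reductionKer] at hx ⊢
  intro n
  by_cases hn : n = d
  · subst hn
    have : (Ψ x).coeff n = (Ψ (DirectSum.decompose 𝒜 x n)).coeff n := by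
      conv_lhs => rw [← DirectSum.sum_support_decompose 𝒜 x, map_sum, finsetSum_coeff]
      refine Finset.sum_eq_single n (fun k _ hk => hΨ k _ (SetLike.coe_mem _) n hk.symm)
        fun h => ?_
      rw [DFinsupp.notMem_support_iff.1 h]
      simp
    rw [← this]
    exact hx n
  · rw [hΨ d _ (SetLike.coe_mem _) n hn]
    exact zero_mem _

/-- The point of `Proj S` that is the kernel of the reduction of a graded homomorphism
`S → V[X]`. -/
noncomputable def reductionPoint (hΨ : ∀ d, ∀ x ∈ 𝒜 d, ∀ n, n ≠ d → (Ψ x).coeff n = 0)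
    (hΨ1 : ∃ x ∈ 𝒜 1, (Ψ x).coeff 1 = 1) : ProjectiveSpectrum 𝒜 where
  asHomogeneousIdeal := ⟨reductionKer Ψ, reductionKer_isHomogeneous 𝒜 hΨ⟩
  isPrime := reductionKer_isPrime
  not_irrelevant_le := by
    obtain ⟨x, hx, hx1⟩ := hΨ1
    intro h
    have h1 : x ∈ reductionKer Ψ := h (HomogeneousIdeal.mem_irrelevant_of_mem 𝒜 one_pos hx)
    have h2 := mem_reductionKer.1 h1 1
    rw [hx1] at h2
    exact h2 isUnit_one

theorem algebraMap_mem_reductionKer [IsLocalRing A] [IsLocalHom β]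
    (hβ : ∀ c, Ψ (algebraMap A S c) = C (β c)) (c : A) :
    algebraMap A S c ∈ reductionKer Ψ ↔ c ∈ IsLocalRing.maximalIdeal A := by
  rw [mem_reductionKer, hβ, IsLocalRing.mem_maximalIdeal, mem_nonunits_iff, ← isUnit_map_iff β]
  constructor
  · intro h
    simpa using h 0
  · intro h n
    rw [coeff_C]
    split_ifs
    · exact h
    · exact zero_mem _

/-- Choose `y ∉ q` with `y a ∈ I S`. All coefficients of `Ψ (y a)` are divisible by `β b`, and some
coefficient of `Ψ y` is a unit of `V`. -/
theorem dvd_of_mem_map (hβ : ∀ c, Ψ (algebraMap A S c) = C (β c)) {I : Ideal A} {a b : A}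
    (hI : I.map β ≤ Ideal.span {β b})
    (h : (HomogeneousLocalization.fromZeroRingHom 𝒜 (reductionKer Ψ).primeCompl).comp
      (algebraMap A (𝒜 0)) a ∈
      I.map ((HomogeneousLocalization.fromZeroRingHom 𝒜 (reductionKer Ψ).primeCompl).comp
        (algebraMap A (𝒜 0)))) : β b ∣ β a := by
  obtain ⟨y, hy, hya⟩ := exists_mul_mem_map 𝒜 (reductionKer Ψ) h
  have hle : I.map (algebraMap A S) ≤ (Ideal.span {C (β b)}).comap Ψ := by
    rw [Ideal.map_le_iff_le_comap]
    intro i hi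
    rw [Ideal.mem_comap, Ideal.mem_comap, hβ, Ideal.mem_span_singleton]
    exact map_dvd C (Ideal.mem_span_singleton.1 (hI (Ideal.mem_map_of_mem β hi)))
  have h1 := hle hya
  rw [Ideal.mem_comap, map_mul, hβ, Ideal.mem_span_singleton, C_dvd_iff_dvd_coeff] at h1
  rw [mem_reductionKer] at hy
  obtain ⟨n, hn⟩ := not_forall.1 hy
  rw [IsLocalRing.mem_maximalIdeal, mem_nonunits_iff, not_not] at hn
  have h2 := h1 n
  rw [coeff_mul_C] at h2
  exact hn.dvd_mul_left.1 h2

end Point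

end Generic

/-! ### The graded map `S → V[X]` attached to `A → V`. -/

/-- If `I` maps into `b V`, there is a homomorphism `A[It] → V[X]` sending `r t ^ d` to
`(r / b ^ d) X ^ d`. -/
theorem exists_rees_hom {V : Type*} [CommRing V] [IsDomain V] (β : A →+* V) {I : Ideal A} {b : A}
    (hb : β b ≠ 0) (hI : I.map β ≤ Ideal.span {β b}) :
    ∃ Ψ : reesAlgebra I →+* V[X], ∀ f n, (Ψ f).coeff n * β b ^ n = β ((f : A[X]).coeff n) := by
  have hcoeff : ∀ (p : V[X]) n, (compRingHom (C (β b) * X) p).coeff n = p.coeff n * β b ^ n :=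
    fun p n => comp_C_mul_X_coeff
  -- The substitution `X ↦ b X` is injective because `β b ≠ 0`; lifting through it divides the
  -- `n`-th coefficient by `b ^ n`.
  obtain ⟨Ψ, hΨ⟩ := exists_ringHom_lift ((mapRingHom β).comp (reesAlgebra I).val.toRingHom)
    (compRingHom (C (β b) * X)) (fun p p' h => by
      ext n
      have := congrArg (fun p => coeff p n) h
      simp only [hcoeff] at this
      exact mul_right_cancel₀ (pow_ne_zero n hb) this) (by
    intro f
    have H : ∀ n, ∃ w, w * β b ^ n = β ((f : A[X]).coeff n) := by
      intro n
      have h1 : (I ^ n).map β ≤ Ideal.span {β b ^ n} := by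
        rw [Ideal.map_pow, ← Ideal.span_singleton_pow]
        exact Ideal.pow_right_mono hI n
      exact Ideal.mem_span_singleton'.1 (h1 (Ideal.mem_map_of_mem β (f.2 n)))
    choose w hw using H
    refine ⟨∑ n ∈ Finset.range ((f : A[X]).natDegree + 1), monomial n (w n), ?_⟩
    ext n
    rw [hcoeff, finsetSum_coeff]
    simp only [coeff_monomial, Finset.sum_ite_eq', Finset.mem_range]
    change _ = ((f : A[X]).map β).coeff n
    rw [coeff_map, ← hw]
    split_ifs with hn
    · rfl
    · rw [hw, coeff_eq_zero_of_natDegree_lt (by omega), map_zero, zero_mul])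
  refine ⟨Ψ, fun f n => ?_⟩
  rw [← hcoeff, hΨ]
  exact coeff_map _ _

/-- `V[X]` is integrally closed, and nonzerodivisors of `A[It]` have nonzero image because `ker β`
is a minimal prime; so the map extends. It sends `b t` to `X`. -/
theorem exists_normalizedRees_hom [IsNoetherianRing A] [IsReduced A] {V : Type*} [CommRing V]
    [IsDomain V] [IsIntegrallyClosed V] {β : A →+* V} (hβ : RingHom.ker β ∈ minimalPrimes A)
    {I : Ideal A} {b : A} (hbI : b ∈ I)
    (hb : β b ≠ 0) (hI : I.map β ≤ Ideal.span {β b}) :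
    ∃ Ψ : NormalizedRees I →+* V[X], (∀ c, Ψ (algebraMap A _ c) = C (β c)) ∧
      (∀ d, ∀ x ∈ normalizedReesGrading I d, ∀ n, n ≠ d → (Ψ x).coeff n = 0) ∧
      ∃ x ∈ normalizedReesGrading I 1, (Ψ x).coeff 1 = 1 := by
  obtain ⟨Ψ₀, hΨ₀⟩ := exists_rees_hom β hb hI
  obtain ⟨Ψ, hΨ⟩ := exists_extension_integralClosure Ψ₀ (by
    intro g hg h0
    obtain ⟨n, hn⟩ := exists_coeff_notMem hg hβ
    apply hn
    rw [RingHom.mem_ker, ← hΨ₀, h0, coeff_zero, zero_mul])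
  have hmon : ∀ (d : ℕ) (r : ↥(I ^ d)) (n : ℕ), n ≠ d → (Ψ₀ (reesMonomial I d r)).coeff n = 0 := by
    intro d r n hn
    have h1 := hΨ₀ (reesMonomial I d r) n
    have h2 : ((reesMonomial I d r : reesAlgebra I) : A[X]).coeff n = 0 :=
      coeff_monomial_of_ne _ hn
    rw [h2, map_zero] at h1
    exact (mul_eq_zero.1 h1).resolve_right (pow_ne_zero n hb)
  have hC : ∀ c, Ψ (algebraMap A _ c) = C (β c) := by
    intro c
    rw [IsScalarTower.algebraMap_apply A (reesAlgebra I), hΨ]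
    ext n
    apply mul_right_cancel₀ (pow_ne_zero n hb)
    rw [hΨ₀, coeff_C]
    change β ((C c : A[X]).coeff n) = _
    rw [coeff_C]
    split_ifs with hn
    · subst hn; simp
    · simp
  refine ⟨Ψ, hC, ?_, algebraMap (reesAlgebra I) _ (reesMonomial I 1 ⟨b, by rwa [pow_one]⟩),
    reesMonomial_mem_grading I 1 _, ?_⟩
  · rintro d x ⟨s, hs, r, hx⟩ n hn
    have hsx : algebraMap A (NormalizedRees I) s * x =
        algebraMap (reesAlgebra I) _ (reesMonomial I d r) := by
      apply Subtype.ext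
      rw [Algebra.smul_def] at hx
      exact hx
    have h1 := congrArg (fun z => (Ψ z).coeff n) hsx
    simp only [map_mul, hC, hΨ, coeff_C_mul, hmon d r n hn] at h1
    -- The denominator `s` is a nonzerodivisor, so it avoids the minimal prime `ker β`.
    exact (mul_eq_zero.1 h1).resolve_left fun h0 =>
      notMem_nonZeroDivisors_of_mem_mem_minimalPrimes (RingHom.mem_ker.2 h0) hβ hs
  · rw [hΨ]
    apply mul_right_cancel₀ hb
    have h1 := hΨ₀ (reesMonomial I 1 ⟨b, by rwa [pow_one]⟩) 1
    have h2 : ((reesMonomial I 1 ⟨b, by rwa [pow_one]⟩ : reesAlgebra I) : A[X]).coeff 1 = b :=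
      coeff_monomial_same _ _
    rw [h2] at h1
    rw [pow_one (β b)] at h1
    rw [h1, one_mul]

/-- A local homomorphism from `A` to a normal local domain in which `I` becomes principal, with
kernel a minimal prime, gives a point of `Proj` of the normalization of `A[It]` over the closed
point of `A`. -/
theorem dvd_of_forall_mem_map [IsNoetherianRing A] [IsReduced A] [IsLocalRing A] {V : Type*}
    [CommRing V] [IsDomain V] [IsIntegrallyClosed V] [IsLocalRing V] {β : A →+* V}
    [IsLocalHom β] (hβ : RingHom.ker β ∈ minimalPrimes A) {I : Ideal A} {a b : A} (hbI : b ∈ I)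
    (hb : β b ≠ 0) (hI : I.map β ≤ Ideal.span {β b})
    (ha : ∀ q : ProjNormalizedRees I, contraction q = IsLocalRing.maximalIdeal A →
      toDegreeZeroLocalization q a ∈ I.map (toDegreeZeroLocalization q)) : β b ∣ β a := by
  obtain ⟨Ψ, hC, hd, h1⟩ := exists_normalizedRees_hom hβ hbI hb hI
  exact dvd_of_mem_map (normalizedReesGrading I) hC hI
    (ha (reductionPoint (normalizedReesGrading I) hd h1)
      (Ideal.ext (algebraMap_mem_reductionKer hC)))

/-! ### Integral equations as reflected elements of the Rees algebra. -/

theorem eval_reflect {f : A[X]} {N : ℕ} (hN : f.natDegree ≤ N) (a : A) :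
    (reflect N f).eval a = ∑ i ∈ Finset.range (N + 1), f.coeff i * a ^ (N - i) := by
  rw [eval_eq_sum_range' (n := N + 1) (Nat.lt_succ_of_le (natDegree_reflect_le.trans (by simpa))),
    ← Finset.sum_range_reflect]
  refine Finset.sum_congr rfl fun i hi => ?_
  have hi' : i ≤ N := Nat.lt_succ_iff.1 (Finset.mem_range.1 hi)
  rw [Nat.add_sub_cancel, coeff_reflect, revAt_le (Nat.sub_le _ _), Nat.sub_sub_self hi']

/-- Membership in `A[It]` means that the `i`-th coefficient lies in `I ^ i`, and `f.coeff 0 = 1`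
makes the reflected polynomial monic. Encoded this way, equations can be multiplied. -/
theorem mem_idealIntegralClosure_of_eval_reflect {I : Ideal A} {a : A} {f : A[X]}
    (hf : f ∈ reesAlgebra I) (h0 : f.coeff 0 = 1) {N : ℕ} (hN : 0 < N) (hd : f.natDegree ≤ N)
    (h : (reflect N f).eval a = 0) : a ∈ idealIntegralClosure I := by
  refine ⟨N, hN, f.coeff, fun i _ => hf i, ?_⟩
  rw [← h, eval_reflect hd, Finset.sum_range_succ', h0, one_mul, Nat.sub_zero, add_comm]
  congr 1
  rw [Finset.range_eq_Ico, Finset.sum_Ico_add' (fun i => f.coeff i * a ^ (N - i)) 0 N 1]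
  rfl

/-- Equations of integral dependence of `a` on `I` modulo each ideal of a finite family can be
combined to a single equation that holds modulo all of them. -/
theorem exists_common_equation {I : Ideal A} {a : A} (T : Finset (Ideal A))
    (H : ∀ P ∈ T, ∃ f ∈ reesAlgebra I, f.coeff 0 = 1 ∧
      ∃ N, f.natDegree ≤ N ∧ (reflect N f).eval a ∈ P) :
    ∃ f ∈ reesAlgebra I, f.coeff 0 = 1 ∧
      ∃ N, 0 < N ∧ f.natDegree ≤ N ∧ ∀ P ∈ T, (reflect N f).eval a ∈ P := by
  classical
  induction T using Finset.induction_on with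
  -- Starting with `N = 1` secures positivity, which the induction step inherits.
  | empty => exact ⟨1, one_mem _, by simp, 1, one_pos, by simp, by simp⟩
  | insert P T hP ih =>
    obtain ⟨f, hf, hf0, N, hN, hfN, h⟩ := ih fun P' hP' => H P' (Finset.mem_insert_of_mem hP')
    obtain ⟨g, hg, hg0, M, hgM, h'⟩ := H P (Finset.mem_insert_self P T)
    refine ⟨f * g, mul_mem hf hg, by simp [mul_coeff_zero, hf0, hg0], N + M, by omega,
      natDegree_mul_le_of_le hfN hgM, fun P' hP' => ?_⟩
    rw [reflect_mul _ _ hfN hgM, eval_mul]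
    rcases Finset.mem_insert.1 hP' with rfl | hP'
    · exact Ideal.mul_mem_left _ _ h'
    · exact Ideal.mul_mem_right _ _ (h P' hP')

/-! ### The valuative alternative and the converse direction. -/

/-- Either `a` satisfies an equation of integral dependence on `I` in the field `K`, or there is a
valuation ring of `K` dominating `A` in which `a` has smaller value than `I`. -/
theorem exists_equation_or_valuationSubring [IsLocalRing A] (I : Ideal A) {K : Type*} [Field K]
    (α : A →+* K) {a : A} (ha : α a ≠ 0) :
    (∃ f ∈ reesAlgebra I, f.coeff 0 = 1 ∧
      ∃ N, f.natDegree ≤ N ∧ α ((reflect N f).eval a) = 0) ∨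
    ∃ V : ValuationSubring K, (∀ c, α c ∈ V) ∧ (∀ c ∈ IsLocalRing.maximalIdeal A,
      α c ∈ V.nonunits) ∧ ∀ i ∈ I, α i * (α a)⁻¹ ∈ V.nonunits := by
  -- Evaluation at `1/a`: the range is the subring `A[I/a]` of `K`. The ideal `J` below consists of
  -- the elements with constant term in the maximal ideal.
  let φ : reesAlgebra I →+* K :=
    (eval₂RingHom α (α a)⁻¹).comp (reesAlgebra I).val.toRingHom
  let J : Ideal (reesAlgebra I) := (IsLocalRing.maximalIdeal A).comap
    (constantCoeff.comp (reesAlgebra I).val.toRingHom)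
  have hφ : ∀ (d : ℕ) (r : ↥(I ^ d)), φ (reesMonomial I d r) = α r * (α a)⁻¹ ^ d := fun d r =>
    eval₂_monomial _ _
  by_cases hJ : J.map φ.rangeRestrict = ⊤
  · left
    have h1 : (1 : φ.range) ∈ J.map φ.rangeRestrict := hJ ▸ Submodule.mem_top
    obtain ⟨f, hf, hf1⟩ := (Ideal.mem_map_iff_of_surjective _ φ.rangeRestrict_surjective).1 h1
    have hf1' : eval₂ α (α a)⁻¹ (f : A[X]) = 1 := congrArg Subtype.val hf1
    have hf0 : (f : A[X]).coeff 0 ∈ IsLocalRing.maximalIdeal A := hf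
    -- `1 - f` vanishes at `1/a` and has unit constant term `u`; dividing by `u` and reflecting
    -- gives the equation for `a`.
    obtain ⟨u, hu⟩ := IsLocalRing.isUnit_one_sub_self_of_mem_nonunits _ hf0
    refine ⟨((↑u⁻¹ : A) • (1 - f) : reesAlgebra I), Subtype.property _, ?_,
      _, le_rfl, ?_⟩
    · simp [← hu]
    · let _ := invertibleOfNonzero (inv_ne_zero ha)
      have h2 := (eval₂_reflect_eq_zero_iff α (α a)⁻¹ _
        (((↑u⁻¹ : A) • (1 - f) : reesAlgebra I) : A[X]) le_rfl).2 (by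
          simp [smul_eq_C_mul, eval₂_mul, eval₂_sub, hf1'])
      rw [invOf_eq_inv, inv_inv, eval₂_at_apply] at h2
      exact h2
  · right
    -- A proper ideal of a subring of `K` consists of nonunits of some valuation ring containing the
    -- subring.
    obtain ⟨V, hV, hVJ⟩ := Ideal.image_subset_nonunits_valuationSubring _ hJ
    have hVJ' : ∀ f ∈ J, φ f ∈ V.nonunits := fun f hf =>
      hVJ ⟨φ.rangeRestrict f, Ideal.mem_map_of_mem _ hf, rfl⟩
    refine ⟨V, fun c => ?_, fun c hc => ?_, fun i hi => ?_⟩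
    · have : φ (reesMonomial I 0 ⟨c, by simp⟩) = α c :=
        (hφ _ _).trans (by rw [pow_zero (α a)⁻¹, mul_one])
      rw [← this]
      exact hV ⟨_, rfl⟩
    · have : φ (reesMonomial I 0 ⟨c, by simp⟩) = α c :=
        (hφ _ _).trans (by rw [pow_zero (α a)⁻¹, mul_one])
      rw [← this]
      refine hVJ' _ ?_
      change (monomial 0 c : A[X]).coeff 0 ∈ IsLocalRing.maximalIdeal A
      rwa [coeff_monomial_same]
    · have : φ (reesMonomial I 1 ⟨i, by rwa [pow_one]⟩) = α i * (α a)⁻¹ :=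
        (hφ _ _).trans (by rw [pow_one (α a)⁻¹])
      rw [← this]
      refine hVJ' _ ?_
      change (monomial 1 i : A[X]).coeff 0 ∈ IsLocalRing.maximalIdeal A
      rw [coeff_monomial_of_ne _ (by simp)]
      exact zero_mem _

theorem exists_equation_at_minimalPrime [IsNoetherianRing A] [IsReduced A] [IsLocalRing A]
    {I : Ideal A} {a : A} {P : Ideal A} (hP : P ∈ minimalPrimes A) (haP : I ≤ P → a ∈ P)
    (ha : ∀ q : ProjNormalizedRees I, contraction q = IsLocalRing.maximalIdeal A →
      toDegreeZeroLocalization q a ∈ I.map (toDegreeZeroLocalization q)) :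
    ∃ f ∈ reesAlgebra I, f.coeff 0 = 1 ∧
      ∃ N, f.natDegree ≤ N ∧ (reflect N f).eval a ∈ P := by
  have hprime : P.IsPrime := hP.1.1
  let K := FractionRing (A ⧸ P)
  have hker : ∀ c : A, algebraMap A K c = 0 ↔ c ∈ P := by
    intro c
    rw [IsScalarTower.algebraMap_apply A (A ⧸ P) K,
      FaithfulSMul.algebraMap_eq_zero_iff, Ideal.Quotient.algebraMap_eq,
      Ideal.Quotient.eq_zero_iff_mem]
  by_cases haP' : a ∈ P
  -- With `f = 1` and `N = 1` the equation is `a = 0` modulo `P`.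
  · exact ⟨1, one_mem _, by simp, 1, by simp, by simpa [reflect_one]⟩
  rcases exists_equation_or_valuationSubring I (algebraMap A K) (mt (hker a).1 haP') with
    ⟨f, hf, hf0, N, hN, h⟩ | ⟨V, hV, hVm, hVI⟩
  · exact ⟨f, hf, hf0, N, hN, (hker _).1 h⟩
  exfalso
  let β : A →+* V := (algebraMap A K).codRestrict V.toSubring hV
  have hβ : ∀ c, (β c : K) = algebraMap A K c := fun _ => rfl
  have hβ0 : ∀ c, β c = 0 ↔ c ∈ P := fun c => by
    rw [← hker, ← hβ, ZeroMemClass.coe_eq_zero]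
  have hkerβ : RingHom.ker β = P := Ideal.ext hβ0
  have hloc : IsLocalHom β := ⟨fun c hc => by
    by_contra hcu
    exact (V.coe_mem_nonunits_iff.1 (hVm c hcu)) hc⟩
  obtain ⟨b, hbI, hb⟩ := exists_generator_of_fg β (IsNoetherian.noetherian I)
  have hb0 : β b ≠ 0 := by
    intro h0
    refine haP' (haP fun i hi => ?_)
    have := hb (Ideal.mem_map_of_mem β hi)
    rw [h0, Ideal.mem_span_singleton, zero_dvd_iff] at this
    exact (hβ0 i).1 this
  obtain ⟨w, hw⟩ := dvd_of_forall_mem_map (hkerβ.symm ▸ hP) hbI hb0 hb ha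
  obtain ⟨hm, hmem⟩ := V.mem_nonunits_iff_exists_mem_maximalIdeal.1 (hVI b hbI)
  -- From `a = b w` it follows that `(b/a) w = 1`, although `b/a` is a nonunit of `V`.
  refine hmem (IsUnit.of_mul_eq_one w (Subtype.ext ?_))
  have hw' : algebraMap A K a = algebraMap A K b * w := congrArg Subtype.val hw
  change algebraMap A K b * (algebraMap A K a)⁻¹ * (w : K) = 1
  rw [mul_right_comm, ← hw', mul_inv_cancel₀ (mt (hker a).1 haP')]

theorem mem_idealIntegralClosure_of_forall [IsNoetherianRing A] [IsReduced A] [IsLocalRing A]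
    {I : Ideal A} {a : A} (hP : ∀ P ∈ minimalPrimes A, I ≤ P → a ∈ P)
    (ha : ∀ q : ProjNormalizedRees I, contraction q = IsLocalRing.maximalIdeal A →
      toDegreeZeroLocalization q a ∈ I.map (toDegreeZeroLocalization q)) :
    a ∈ idealIntegralClosure I := by
  have hfin := minimalPrimes.finite_of_isNoetherianRing A
  obtain ⟨f, hf, hf0, N, hN, hfN, h⟩ := exists_common_equation hfin.toFinset fun P hP' =>
    exists_equation_at_minimalPrime (hfin.mem_toFinset.1 hP') (hP P (hfin.mem_toFinset.1 hP')) ha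
  exact mem_idealIntegralClosure_of_eval_reflect hf hf0 hN hfN
    (eq_zero_of_forall_mem fun P hP' => h P (hfin.mem_toFinset.2 hP'))

end ReesNormalization

theorem mainTheorem11 {A : Type*} [CommRing A] [IsNoetherianRing A] [IsReduced A] [IsLocalRing A]
    (I : Ideal A) (a : A) :
    (a ∈ idealIntegralClosure I →
      ∀ q : ProjNormalizedRees I, contraction q = IsLocalRing.maximalIdeal A →
        toDegreeZeroLocalization q a ∈ I.map (toDegreeZeroLocalization q)) ∧
    ((∀ P ∈ minimalPrimes A, I ≤ P → a ∈ P) →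
      (∀ q : ProjNormalizedRees I, contraction q = IsLocalRing.maximalIdeal A →
        toDegreeZeroLocalization q a ∈ I.map (toDegreeZeroLocalization q)) →
      a ∈ idealIntegralClosure I) :=
  ⟨fun ha q _ => toDegreeZeroLocalization_mem_map ha q, mem_idealIntegralClosure_of_forall⟩
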